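/- Private information retrieval (PIR) setting. There are $N\ge 1$ databases, each storing the same $K\ge 1$ messages $W_1,\dots,W_K$, and each message is an arbitrary string of $L$ symbols from an $M$-ary alphabet. A scheme consists, for each desired index $\theta\in\{1,\dots,K\}$, of random queries $Q_1^{[\theta]},\dots,Q_N^{[\theta]}$ generated without knowledge of the messages. Database $n$ returns an answer $A_n^{[\theta]}$, a string over an $M'$-ary alphabet, which is a function (not depending on $\theta$) of the query it received and of the messages, and whose length is determined by the query. Correctness: $W_\theta$ is a function of $(A_n^{[\theta]},Q_n^{[\theta]})_{n\le N}$, for every $\theta$ and every choice of the messages. Privacy: for every $n$, the distribution of $Q_n^{[\theta]}$ does not depend on $\theta$. The download cost of a scheme is the maximum, over $\theta$ and over all realizations of the queries, of $\sum_{n=1}^N |A_n^{[\theta]}|$, and the optimal download cost $D_L$ is the minimum download cost over all correct and private schemes. Theorem. Let $K,N\ge 1$, $M,M'\ge 2$ with $M'\ne M$, let $L$ be a natural number, and put $C=\left(1+\frac1N+\cdots+\frac1{N^{K-1}}\right)^{-1}$ and $L'=\lceil L\log_{M'}M\rceil$. (a) The download cost $\lceil L'/C\rceil$ is achievable by re-encoding: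 there are an injective map from $M$-ary strings of length $L$ to $M'$-ary strings of length $L'$ and a correct and private scheme for messages of $L'$ symbols over the $M'$-ary alphabet, with $M'$-ary answers and download cost $\lceil L'/C\rceil$, such that applying this scheme to the images of the messages is a correct and private scheme for the original messages with download cost $\lceil L'/C\rceil$. (b) Every correct and private scheme has download cost at least $\left\lceil \frac{L\log_{M'}M}{C}\right\rceil$. (c) The optimal download cost $D_L$ exists, and if $N\ge 2$ (or $N=1$ and $K\le 3$), then $D_L\in\left\{\lceil L'/C\rceil,\ \lceil L'/C\rceil-1,\ \lceil L'/C\rceil-2\right\}$. -/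

import Mathlib

open MeasureTheory ProbabilityTheory

/-- A tuple of `K` messages, each a string of `L` symbols from an `M`-ary alphabet. -/
abbrev Messages (K L M : ℕ) : Type := Fin K → Fin L → Fin M

/-- The data of a private information retrieval protocol with `N` replicated databases, each storing
`K` messages of `L` symbols from an `M`-ary alphabet, with answers over an `M'`-ary alphabet.
The random queries live on a probability space that does not involve the messages.  Database `n`
sees only its own query `q` and the messages, so its answer does not depend on the desired index in
any other way.  The length of an answer is determined by the query alone. -/
structure PIRScheme (K N L M M' : ℕ) where
  /-- the private randomness of the user -/
  Ω : Type
  [measurableSpaceΩ : MeasurableSpace Ω]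
  P : Measure Ω
  [isProbabilityMeasure : IsProbabilityMeasure P]
  /-- the set of possible queries to database `n` -/
  Query : Fin N → Type
  [measurableSpaceQuery : ∀ n, MeasurableSpace (Query n)]
  /-- `query θ n` is the random query sent to database `n` when message `θ` is desired -/
  query : Fin K → (n : Fin N) → Ω → Query n
  measurable_query : ∀ θ n, Measurable (query θ n)
  /-- the answering string of database `n`, a function of its query and the stored messages -/
  answer : (n : Fin N) → Query n → Messages K L M → List (Fin M')
  measurableSet_answer : ∀ n w s, MeasurableSet {q | answer n q w = s}
  /-- the number of symbols in the answer of database `n` to a query -/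
  answerLength : (n : Fin N) → Query n → ℕ
  length_answer : ∀ n q w, (answer n q w).length = answerLength n q

namespace PIRScheme

attribute [instance] measurableSpaceΩ isProbabilityMeasure measurableSpaceQuery

variable {K N L M M' : ℕ}

/-- Correctness: the desired message is a function of all the answers and all the queries. -/
def IsCorrect (S : PIRScheme K N L M M') : Prop :=
  ∀ θ : Fin K, ∃ decode : (Fin N → List (Fin M')) → ((n : Fin N) → S.Query n) → (Fin L → Fin M),
    ∀ (ω : S.Ω) (w : Messages K L M),
      decode (fun n => S.answer n (S.query θ n ω) w) (fun n => S.query θ n ω) = w θ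

/-- Privacy: the query to each database is identically distributed for all desired indices. -/
def IsPrivate (S : PIRScheme K N L M M') : Prop :=
  ∀ (θ θ' : Fin K) (n : Fin N), IdentDistrib (S.query θ n) (S.query θ' n) S.P S.P

/-- `D` is the download cost: the maximum, over all realizations of the queries, of the total number
of symbols downloaded from all databases. -/
def HasDownloadCost (S : PIRScheme K N L M M') (D : ℕ) : Prop :=
  IsGreatest {d | ∃ (θ : Fin K) (ω : S.Ω), d = ∑ n, S.answerLength n (S.query θ n ω)} D

/-- Re-encoding: each message is first mapped by `e` to a string of `L'` symbols from an `A`-ary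
alphabet, and then the scheme `S` for such strings is used. -/
def reencode {L' A : ℕ} (S : PIRScheme K N L' A M') (e : (Fin L → Fin M) → (Fin L' → Fin A)) :
    PIRScheme K N L M M' where
  Ω := S.Ω
  P := S.P
  Query := S.Query
  query := S.query
  measurable_query := S.measurable_query
  answer n q w := S.answer n q (fun k => e (w k))
  measurableSet_answer n w s := S.measurableSet_answer n (fun k => e (w k)) s
  answerLength := S.answerLength
  length_answer n q w := S.length_answer n q (fun k => e (w k))

/-- `D` is the download cost of a correct and private scheme `S`. -/
def Achieves (S : PIRScheme K N L M M') (D : ℕ) : Prop :=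
  S.IsCorrect ∧ S.IsPrivate ∧ S.HasDownloadCost D

end PIRScheme

/-- `D` is the optimal download cost: the minimum of the download costs of all correct and private
schemes. -/
def IsOptimalDownloadCost (K N L M M' D : ℕ) : Prop :=
  IsLeast {d | ∃ S : PIRScheme K N L M M', S.Achieves d} D

/-- The PIR capacity expression `C = (1 + 1/N + ⋯ + 1/N^(K-1))⁻¹`. -/
noncomputable def pirCapacity (K N : ℕ) : ℝ :=
  (∑ i ∈ Finset.range K, 1 / (N : ℝ) ^ i)⁻¹

/-- `L' = ⌈L log_{M'} M⌉`, the number of `M'`-ary symbols needed for `L` symbols that are `M`-ary. -/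
noncomputable def reencodedLength (L M M' : ℕ) : ℕ :=
  ⌈(L : ℝ) * Real.logb M' M⌉₊

/-! Lower bound. Fix the queries and let the messages be independent and uniform. If `θ ∉ T`, the
answers to the queries for `θ` determine message `θ`, so their joint entropy given the messages in
`T` is `L log M` plus their joint entropy given those in `insert θ T`. The former is at most the sum
of the individual answer entropies; the latter is at least their average over the databases. After
integrating over the queries, privacy allows `θ` to be replaced, one database at a time, by a
message outside `insert θ T`. Iterating through all messages builds the geometric sum `1 / C`
(`integral_sum_answerEntropy_ge`). An answer of length `ℓ` has entropy at most `ℓ log M'`, which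
gives `Achieves.le_downloadCost`.

Achievability. For equal alphabets `⌈L / C⌉` is attained by combining two schemes.
`UniformScheme.sideInformation` has rate exactly `C` on blocks of `N ^ (K - 1)` symbols. The
remainder is split into groups of at most `N - 1` symbols, each retrieved by `UniformScheme.cyclic`
at the price of one extra symbol. The remainder is short enough that the total stays below `L / C +
1` (`IsFeasible.exists_lt`).

Gap. Rounding up to `L'` adds less than one symbol, so `L' / C` exceeds the lower bound by less than
`1 / C`. This is at most 2 when `N ≥ 2`, and equals `K` when `N = 1`, where integrality of `L' K`
saves one more unit. -/

/-! ### Entropy of functions of a uniformly distributed variable -/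

section Entropy

variable {X α β γ : Type*} [Fintype X]

open Classical in
/-- The number of points on which `f` takes the same value as at `x`. -/
noncomputable def fiberCard (f : X → α) (x : X) : ℕ :=
  (Finset.univ.filter fun y => f y = f x).card

lemma fiberCard_pos (f : X → α) (x : X) : 0 < fiberCard f x :=
  Finset.card_pos.2 ⟨x, by simp⟩

lemma fiberCard_le_card (f : X → α) (x : X) : fiberCard f x ≤ Fintype.card X :=
  Finset.card_le_univ _

lemma fiberCard_mono {f : X → α} {g : X → β} (h : ∀ x y, f x = f y → g x = g y) (x : X) :
    fiberCard f x ≤ fiberCard g x := by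
  classical
  unfold fiberCard
  refine Finset.card_le_card fun y hy => ?_
  simp only [Finset.mem_filter, Finset.mem_univ, true_and] at hy ⊢
  exact h _ _ hy

lemma fiberCard_congr {f : X → α} {g : X → β} (h : ∀ x y, f x = f y ↔ g x = g y) :
    fiberCard f = fiberCard g :=
  funext fun x => le_antisymm (fiberCard_mono (fun x y => (h x y).1) x)
    (fiberCard_mono (fun x y => (h x y).2) x)

/-- The entropy (in nats) of `f x` given `g x` for a uniformly distributed `x`. -/
noncomputable def condEntropy (f : X → α) (g : X → β) : ℝ :=
  (∑ x, (Real.log (fiberCard g x) - Real.log (fiberCard (fun y => (f y, g y)) x))) /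
    Fintype.card X

lemma condEntropy_congr {f : X → α} {f' : X → γ} (g : X → β)
    (h : ∀ x y, f x = f y ↔ f' x = f' y) : condEntropy f g = condEntropy f' g := by
  unfold condEntropy
  rw [fiberCard_congr (f := fun y => (f y, g y)) (g := fun y => (f' y, g y))]
  intro x y
  simp [h]

lemma condEntropy_mono {f : X → α} {f' : X → γ} (g : X → β)
    (h : ∀ x y, f x = f y → f' x = f' y) : condEntropy f' g ≤ condEntropy f g := by
  unfold condEntropy
  refine div_le_div_of_nonneg_right (Finset.sum_le_sum fun x _ => ?_) (Nat.cast_nonneg _)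
  refine sub_le_sub_left (Real.log_le_log (by exact_mod_cast fiberCard_pos _ _) ?_) _
  refine Nat.cast_le.2 (fiberCard_mono (fun x y hxy => ?_) x)
  simp only [Prod.mk.injEq] at hxy ⊢
  exact ⟨h _ _ hxy.1, hxy.2⟩

lemma condEntropy_nonneg (f : X → α) (g : X → β) : 0 ≤ condEntropy f g := by
  unfold condEntropy
  refine div_nonneg (Finset.sum_nonneg fun x _ => sub_nonneg.2 ?_) (Nat.cast_nonneg _)
  refine Real.log_le_log (by exact_mod_cast fiberCard_pos _ _) ?_
  exact Nat.cast_le.2 (fiberCard_mono (fun x y hxy => (Prod.mk.inj hxy).2) x)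

lemma condEntropy_le_log_card (f : X → α) (g : X → β) :
    condEntropy f g ≤ Real.log (Fintype.card X) := by
  unfold condEntropy
  rcases isEmpty_or_nonempty X with hX | hX
  · simp
  rw [div_le_iff₀ (by exact_mod_cast Fintype.card_pos)]
  calc _ ≤ ∑ x : X, Real.log (Fintype.card X) := by
        refine Finset.sum_le_sum fun x _ => ?_
        have h1 : Real.log (fiberCard g x) ≤ Real.log (Fintype.card X) :=
          Real.log_le_log (by exact_mod_cast fiberCard_pos _ _)
            (Nat.cast_le.2 (fiberCard_le_card _ _))
        have h2 : 0 ≤ Real.log (fiberCard (fun y => (f y, g y)) x) := Real.log_natCast_nonneg _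
        linarith
    _ = _ := by simp [mul_comm]

/-- The weights `1 / fiberCard f` add up to one over each fiber of `f`, and `g` is constant there.
-/
lemma sum_inv_fiberCard_filter (f : X → α) (g : X → ℝ) (hg : ∀ x y, f x = f y → g x = g y)
    (y : X) (p : X → Prop) [DecidablePred p] (hp : ∀ x, p x ↔ f x = f y) :
    ∑ x, (if p x then g x / fiberCard f x else 0) = g y := by
  classical
  have h1 : ∀ x, (if p x then g x / (fiberCard f x : ℝ) else 0) =
      if f x = f y then g y / (fiberCard f y : ℝ) else 0 := by
    intro x
    by_cases h : f x = f y
    · rw [if_pos ((hp x).2 h), if_pos h, hg _ _ h]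
      congr 2
      unfold fiberCard
      rw [h]
    · rw [if_neg (fun hx => h ((hp x).1 hx)), if_neg h]
  simp_rw [h1]
  rw [← Finset.sum_filter, Finset.sum_const, nsmul_eq_mul]
  have h2 : ((Finset.univ.filter fun x => f x = f y).card : ℝ) = fiberCard f y := by
    unfold fiberCard
    congr!
  rw [h2]
  have := fiberCard_pos f y
  field_simp

lemma cast_fiberCard (f : X → α) (x : X) [∀ y, Decidable (f y = f x)] :
    (fiberCard f x : ℝ) = ∑ y, if f y = f x then 1 else 0 := by
  classical
  unfold fiberCard
  rw [Finset.sum_boole]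
  congr!

/-- The numerator counts pairs `(y, z)` where `y` agrees with `x` under `(f, g)` and `z` under `(f',
g)`. For a fixed pair the admissible `x` form one fiber of `((f, f'), g)` or none, so summing over
`x` first leaves at most `1 / fiberCard g y`, and only if `g z = g y`. Summing over `z` then gives
at most one for each `y`. -/
lemma sum_fiberCard_mul_div_le (f : X → α) (f' : X → γ) (g : X → β) :
    ∑ x, (fiberCard (fun y => (f y, g y)) x : ℝ) * fiberCard (fun y => (f' y, g y)) x /
      (fiberCard g x * fiberCard (fun y => ((f y, f' y), g y)) x) ≤ Fintype.card X := by
  classical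
  calc _ = ∑ x, ∑ y, ∑ z, (if (f y, g y) = (f x, g x) ∧ (f' z, g z) = (f' x, g x) then
          ((fiberCard g x : ℝ))⁻¹ / fiberCard (fun y => ((f y, f' y), g y)) x else 0) := by
        refine Finset.sum_congr rfl fun x _ => ?_
        rw [cast_fiberCard (fun y => (f y, g y)), cast_fiberCard (fun y => (f' y, g y)),
          Finset.sum_mul_sum, Finset.sum_div]
        refine Finset.sum_congr rfl fun y _ => ?_
        rw [Finset.sum_div]
        refine Finset.sum_congr rfl fun z _ => ?_
        rw [ite_and]
        split_ifs <;> simp [div_eq_mul_inv, mul_comm]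
    _ = ∑ y, ∑ z, ∑ x, (if (f y, g y) = (f x, g x) ∧ (f' z, g z) = (f' x, g x) then
          ((fiberCard g x : ℝ))⁻¹ / fiberCard (fun y => ((f y, f' y), g y)) x else 0) := by
        rw [Finset.sum_comm]
        exact Finset.sum_congr rfl fun y _ => Finset.sum_comm
    _ ≤ ∑ y, ∑ z, (if g z = g y then ((fiberCard g y : ℝ))⁻¹ else 0) := by
        refine Finset.sum_le_sum fun y _ => Finset.sum_le_sum fun z _ => ?_
        by_cases h : ∃ x, (f y, g y) = (f x, g x) ∧ (f' z, g z) = (f' x, g x)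
        · obtain ⟨x₀, h₁, h₂⟩ := h
          simp only [Prod.mk.injEq] at h₁ h₂
          have hg : ∀ x y, g x = g y → ((fiberCard g x : ℝ))⁻¹ = ((fiberCard g y : ℝ))⁻¹ := by
            intro x y hxy
            unfold fiberCard
            rw [hxy]
          rw [sum_inv_fiberCard_filter (fun y => ((f y, f' y), g y))
            (fun x => ((fiberCard g x : ℝ))⁻¹)
            (fun x y hxy => hg x y (by simp at hxy; exact hxy.2)) x₀, if_pos (h₂.2.trans h₁.2.symm),
            hg y x₀ h₁.2]
          intro x
          simp only [Prod.mk.injEq]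
          rw [h₁.1, h₁.2, h₂.1, h₂.2]
          constructor
          · rintro ⟨⟨a, b⟩, c, d⟩
            exact ⟨⟨a.symm, c.symm⟩, b.symm⟩
          · rintro ⟨⟨a, b⟩, c⟩
            exact ⟨⟨a.symm, c.symm⟩, b.symm, c.symm⟩
        · push Not at h
          rw [Finset.sum_eq_zero fun x _ => if_neg fun hx => h x hx.1 hx.2]
          split_ifs <;> positivity
    _ = ∑ y : X, (1 : ℝ) := by
        refine Finset.sum_congr rfl fun y _ => ?_
        have := fiberCard_pos g y
        have h := cast_fiberCard g y
        rw [← Finset.sum_filter, Finset.sum_const, nsmul_eq_mul, ← Finset.sum_boole, ← h]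
        field_simp
    _ = _ := by simp

/-- Apply `log t ≤ t - 1` pointwise to the ratio in `sum_fiberCard_mul_div_le`, whose average is at
most one. -/
lemma condEntropy_prod_le (f : X → α) (f' : X → γ) (g : X → β) :
    condEntropy (fun x => (f x, f' x)) g ≤ condEntropy f g + condEntropy f' g := by
  unfold condEntropy
  rw [← add_div, ← Finset.sum_add_distrib]
  refine div_le_div_of_nonneg_right ?_ (Nat.cast_nonneg _)
  rw [← sub_nonneg, ← Finset.sum_sub_distrib]
  have key := sum_fiberCard_mul_div_le f f' g
  have h : ∑ x, (1 - (fiberCard (fun y => (f y, g y)) x : ℝ) *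
      fiberCard (fun y => (f' y, g y)) x /
      (fiberCard g x * fiberCard (fun y => ((f y, f' y), g y)) x)) ≥ 0 := by
    rw [Finset.sum_sub_distrib]
    simpa using key
  refine le_trans h (Finset.sum_le_sum fun x _ => ?_)
  have p1 : (0 : ℝ) < fiberCard (fun y => (f y, g y)) x := by exact_mod_cast fiberCard_pos _ _
  have p2 : (0 : ℝ) < fiberCard (fun y => (f' y, g y)) x := by exact_mod_cast fiberCard_pos _ _
  have p3 : (0 : ℝ) < fiberCard g x := by exact_mod_cast fiberCard_pos _ _
  have p4 : (0 : ℝ) < fiberCard (fun y => ((f y, f' y), g y)) x := by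
    exact_mod_cast fiberCard_pos _ _
  have := Real.log_le_sub_one_of_pos (div_pos (mul_pos p1 p2) (mul_pos p3 p4))
  rw [Real.log_div (by positivity) (by positivity), Real.log_mul p1.ne' p2.ne',
    Real.log_mul p3.ne' p4.ne'] at this
  linarith

lemma condEntropy_pi_le {ι : Type*} [Fintype ι] (f : ι → X → α) (g : X → β) :
    condEntropy (fun x i => f i x) g ≤ ∑ i, condEntropy (f i) g := by
  classical
  suffices H : ∀ s : Finset ι, condEntropy (fun x (i : s) => f i x) g ≤
      ∑ i ∈ s, condEntropy (f i) g by
    refine le_trans (le_of_eq (condEntropy_congr g fun x y => ?_)) (H Finset.univ)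
    simp [funext_iff]
  intro s
  induction s using Finset.induction_on with
  | empty =>
    rw [Finset.sum_empty, condEntropy]
    rw [fiberCard_congr (f := fun y => ((fun i : (∅ : Finset ι) => f i y), g y)) (g := g)]
    · simp
    · intro x y
      simp [funext_iff]
  | insert a s ha ih =>
    rw [Finset.sum_insert ha]
    refine le_trans (le_of_eq ?_) ((condEntropy_prod_le (f a) (fun x (i : s) => f i x) g).trans
      (by gcongr))
    refine condEntropy_congr g fun x y => ?_
    simp [funext_iff]

lemma condEntropy_le_log_of_mem (f : X → α) (g : X → β) (s : Finset α) (hf : ∀ x, f x ∈ s)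
    (hg : ∀ x y, g x = g y) : condEntropy f g ≤ Real.log s.card := by
  classical
  rcases isEmpty_or_nonempty X with hX | ⟨⟨x₀⟩⟩
  · simpa [condEntropy] using Real.log_natCast_nonneg _
  have hX : (0 : ℝ) < Fintype.card X := by
    have : Nonempty X := ⟨x₀⟩
    exact_mod_cast Fintype.card_pos
  have hs : (0 : ℝ) < s.card := by exact_mod_cast Finset.card_pos.2 ⟨_, hf x₀⟩
  unfold condEntropy
  rw [div_le_iff₀ hX, fiberCard_congr (f := fun y => (f y, g y)) (g := f)
    (fun x y => by simp [hg x y])]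
  have key : ∑ x, (1 : ℝ) / fiberCard f x ≤ s.card := by
    calc ∑ x, (1 : ℝ) / fiberCard f x
        = ∑ x, ∑ a ∈ s, (if f x = a then (1 : ℝ) / fiberCard f x else 0) := by
          refine Finset.sum_congr rfl fun x _ => ?_
          rw [Finset.sum_ite_eq, if_pos (hf x)]
      _ = ∑ a ∈ s, ∑ x, (if f x = a then (1 : ℝ) / fiberCard f x else 0) := Finset.sum_comm
      _ ≤ ∑ a ∈ s, (1 : ℝ) := by
          refine Finset.sum_le_sum fun a _ => ?_
          by_cases h : ∃ y, f y = a
          · obtain ⟨y, rfl⟩ := h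
            exact (sum_inv_fiberCard_filter f (fun _ => 1) (fun _ _ _ => rfl) y _
              (fun x => Iff.rfl)).le
          · push Not at h
            rw [Finset.sum_eq_zero fun x _ => if_neg (h x)]
            exact zero_le_one
      _ = _ := by simp
  -- This is `log t ≤ t - 1` at `t = |X| / (|s| * fiberCard f x)`; by `key` the average of `t` is at
  -- most one.
  have h2 : ∀ x, Real.log (fiberCard g x) - Real.log (fiberCard f x) ≤
      Real.log s.card + (Fintype.card X / s.card * (1 / fiberCard f x) - 1) := by
    intro x
    have p1 : (0 : ℝ) < fiberCard f x := by exact_mod_cast fiberCard_pos _ _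
    have p2 : (0 : ℝ) < fiberCard g x := by exact_mod_cast fiberCard_pos _ _
    have := Real.log_le_sub_one_of_pos
      (mul_pos (div_pos hX hs) (one_div_pos.2 p1))
    rw [Real.log_mul (by positivity) (by positivity), Real.log_div hX.ne' hs.ne', one_div,
      Real.log_inv, ← one_div] at this
    have h3 : Real.log (fiberCard g x) ≤ Real.log (Fintype.card X) :=
      Real.log_le_log p2 (Nat.cast_le.2 (fiberCard_le_card _ _))
    linarith
  refine (Finset.sum_le_sum fun x _ => h2 x).trans ?_
  rw [Finset.sum_add_distrib, Finset.sum_sub_distrib, ← Finset.mul_sum]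
  have h4 : (Fintype.card X / s.card * ∑ x, (1 : ℝ) / fiberCard f x) ≤ Fintype.card X := by
    calc _ ≤ (Fintype.card X / s.card * s.card : ℝ) := by gcongr
      _ = _ := by field_simp
  simp only [Finset.sum_const, Finset.card_univ, nsmul_eq_mul, mul_one]
  linarith

end Entropy

/-! ### The lower bound on the download cost -/

/-- Coordinate `θ` is free in the larger fiber: record its value, then overwrite it by `w θ`. -/
lemma fiberCard_restrict_eq_mul {κ V : Type*} [Fintype κ] [DecidableEq κ] [Fintype V]
    {T : Finset κ} {θ : κ} (hθ : θ ∉ T) (w : κ → V) :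
    fiberCard (T.restrict (π := fun _ => V)) w =
      Fintype.card V * fiberCard ((insert θ T).restrict (π := fun _ => V)) w := by
  classical
  unfold fiberCard
  rw [← Finset.card_univ, ← Finset.card_product]
  refine Finset.card_nbij' (fun y => (y θ, Function.update y θ (w θ)))
    (fun p => Function.update p.2 θ p.1) ?_ ?_ ?_ ?_
  · intro y hy
    simp only [Finset.coe_filter, Finset.mem_univ, true_and, Set.mem_ofPred_eq, funext_iff,
      Finset.restrict, Subtype.forall] at hy
    simp only [Finset.coe_product, Finset.coe_univ, Finset.coe_filter, Finset.mem_univ, true_and,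
      Set.mem_prod, Set.mem_univ, Set.mem_ofPred_eq, funext_iff, Finset.restrict, Subtype.forall]
    intro k hk
    by_cases hkθ : k = θ
    · subst hkθ; simp
    · rw [Function.update_of_ne hkθ]
      exact hy k ((Finset.mem_insert.1 hk).resolve_left hkθ)
  · rintro ⟨v, y⟩ hy
    simp only [Finset.coe_product, Finset.coe_univ, Finset.coe_filter, Finset.mem_univ, true_and,
      Set.mem_prod, Set.mem_univ, Set.mem_ofPred_eq, funext_iff, Finset.restrict,
      Subtype.forall] at hy
    simp only [Finset.coe_filter, Finset.mem_univ, true_and, Set.mem_ofPred_eq, funext_iff,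
      Finset.restrict, Subtype.forall]
    intro k hk
    rw [Function.update_of_ne (ne_of_mem_of_not_mem hk hθ)]
    exact hy k (Finset.mem_insert_of_mem hk)
  · intro y _
    simp
  · rintro ⟨v, y⟩ hy
    simp only [Finset.coe_product, Finset.coe_univ, Finset.coe_filter, Finset.mem_univ, true_and,
      Set.mem_prod, Set.mem_univ, Set.mem_ofPred_eq, funext_iff, Finset.restrict,
      Subtype.forall] at hy
    have := hy θ (Finset.mem_insert_self _ _)
    simp [← this]

/-- Chain rule: as `f` already determines coordinate `θ`, revealing it leaves the joint fibers
unchanged and shrinks only the conditioning fiber, by the factor `|V|`. -/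
lemma condEntropy_restrict_eq_add {κ V α : Type*} [Fintype κ] [DecidableEq κ] [Fintype V]
    [Nonempty V] {T : Finset κ} {θ : κ} (hθ : θ ∉ T) (f : (κ → V) → α)
    (hf : ∀ w w', f w = f w' → w θ = w' θ) :
    condEntropy f (T.restrict (π := fun _ => V)) = Real.log (Fintype.card V) +
      condEntropy f ((insert θ T).restrict (π := fun _ => V)) := by
  unfold condEntropy
  have hX : (0 : ℝ) < Fintype.card (κ → V) := by exact_mod_cast Fintype.card_pos
  have h : ∀ w, fiberCard (fun y => (f y, T.restrict (π := fun _ => V) y)) w =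
      fiberCard (fun y => (f y, (insert θ T).restrict (π := fun _ => V) y)) w := by
    intro w
    refine congr_fun (fiberCard_congr fun x y => ?_) w
    simp only [Prod.mk.injEq, funext_iff, Finset.restrict, Subtype.forall, Finset.mem_insert,
      forall_eq_or_imp]
    exact ⟨fun h => ⟨h.1, hf _ _ h.1, h.2⟩, fun h => ⟨h.1, h.2.2⟩⟩
  rw [eq_comm, add_div' _ _ _ hX.ne']
  congr 1
  rw [mul_comm, ← nsmul_eq_mul, ← Finset.card_univ, ← Finset.sum_const, ← Finset.sum_add_distrib]
  refine Finset.sum_congr rfl fun w _ => ?_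
  have p1 : (0 : ℝ) < Fintype.card V := by exact_mod_cast Fintype.card_pos
  have p2 : (0 : ℝ) < fiberCard ((insert θ T).restrict (π := fun _ => V)) w := by
    exact_mod_cast fiberCard_pos _ _
  rw [h w, fiberCard_restrict_eq_mul hθ, Nat.cast_mul, Real.log_mul p1.ne' p2.ne']
  ring

lemma card_list_length_le (A ℓ : ℕ) : ∃ s : Finset (List (Fin A)), s.card = A ^ ℓ ∧
    ∀ l : List (Fin A), l.length = ℓ → l ∈ s := by
  classical
  refine ⟨(Finset.univ : Finset (List.Vector (Fin A) ℓ)).map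
    ⟨List.Vector.toList, List.Vector.toList_injective⟩, ?_, ?_⟩
  · rw [Finset.card_map, Finset.card_univ, card_vector, Fintype.card_fin]
  · intro l hl
    exact Finset.mem_map.2 ⟨⟨l, hl⟩, Finset.mem_univ _, rfl⟩

namespace PIRScheme

variable {K N L M M' : ℕ} (S : PIRScheme K N L M M')

/-- The entropy of the answer of database `n` to the query `q`, given the messages in `T`. -/
noncomputable def answerEntropy (T : Finset (Fin K)) (n : Fin N) (q : S.Query n) : ℝ :=
  condEntropy (S.answer n q) (T.restrict (π := fun _ => Fin L → Fin M))

lemma measurable_answerEntropy (T : Finset (Fin K)) (n : Fin N) :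
    Measurable (S.answerEntropy T n) := by
  classical
  unfold answerEntropy condEntropy
  refine Measurable.div_const (Finset.measurable_sum _ fun w _ => Measurable.const_sub ?_ _) _
  refine Real.measurable_log.comp ?_
  simp_rw [cast_fiberCard]
  refine Finset.measurable_sum _ fun w' _ => ?_
  refine Measurable.ite ?_ measurable_const measurable_const
  -- Two answers agree exactly if both equal some common string, and there are countably many
  -- strings.
  have : {q : S.Query n | (S.answer n q w', T.restrict (π := fun _ => Fin L → Fin M) w') =
      (S.answer n q w, T.restrict (π := fun _ => Fin L → Fin M) w)} =
      ⋃ s : List (Fin M'), ({q | S.answer n q w' = s} ∩ {q | S.answer n q w = s}) ∩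
        {_q | T.restrict (π := fun _ => Fin L → Fin M) w' =
          T.restrict (π := fun _ => Fin L → Fin M) w} := by
    ext q
    simp only [Prod.mk.injEq, Set.mem_ofPred_eq, Set.mem_iUnion, Set.mem_inter_iff]
    constructor
    · rintro ⟨h1, h2⟩
      exact ⟨_, ⟨h1, rfl⟩, h2⟩
    · rintro ⟨s, ⟨h1, h2⟩, h3⟩
      exact ⟨h1.trans h2.symm, h3⟩
  rw [this]
  exact MeasurableSet.iUnion fun s => ((S.measurableSet_answer n w' s).inter
    (S.measurableSet_answer n w s)).inter (MeasurableSet.const _)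

lemma integrable_answerEntropy (T : Finset (Fin K)) (θ : Fin K) (n : Fin N) :
    Integrable (fun ω => S.answerEntropy T n (S.query θ n ω)) S.P := by
  refine Integrable.of_bound
    ((S.measurable_answerEntropy T n).comp (S.measurable_query θ n)).aestronglyMeasurable
    (Real.log (Fintype.card (Messages K L M))) (Filter.Eventually.of_forall fun ω => ?_)
  rw [answerEntropy, Real.norm_of_nonneg (condEntropy_nonneg _ _)]
  exact condEntropy_le_log_card _ _

variable {S}

lemma IsPrivate.integral_answerEntropy_eq (hS : S.IsPrivate) (T : Finset (Fin K))
    (θ θ' : Fin K) (n : Fin N) :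
    ∫ ω, S.answerEntropy T n (S.query θ n ω) ∂S.P =
      ∫ ω, S.answerEntropy T n (S.query θ' n ω) ∂S.P :=
  ((hS θ θ' n).comp (S.measurable_answerEntropy T n)).integral_eq

lemma IsCorrect.sum_answerEntropy_ge (hS : S.IsCorrect) (hN : 1 ≤ N) (hM : 1 ≤ M)
    {T : Finset (Fin K)} {θ : Fin K} (hθ : θ ∉ T) (ω : S.Ω) :
    L * Real.log M + 1 / N * ∑ n, S.answerEntropy (insert θ T) n (S.query θ n ω) ≤
      ∑ n, S.answerEntropy T n (S.query θ n ω) := by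
  classical
  have : Nonempty (Fin M) := ⟨⟨0, hM⟩⟩
  obtain ⟨decode, hd⟩ := hS θ
  refine le_trans ?_ (condEntropy_pi_le _ _)
  rw [condEntropy_restrict_eq_add hθ]
  · simp only [Fintype.card_pi, Fintype.card_fin, Finset.prod_const, Finset.card_univ,
      Nat.cast_pow, Real.log_pow]
    gcongr
    have hN' : (0 : ℝ) < N := by exact_mod_cast hN
    -- The joint entropy dominates the entropy of each single answer, hence their average.
    rw [one_div, inv_mul_le_iff₀ hN']
    calc _ ≤ ∑ n : Fin N, condEntropy (fun w n => S.answer n (S.query θ n ω) w)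
          ((insert θ T).restrict (π := fun _ => Fin L → Fin M)) :=
          Finset.sum_le_sum fun n _ => condEntropy_mono _ fun x y h => congr_fun h n
      _ = _ := by simp
  · intro w w' h
    rw [← hd ω w, ← hd ω w', h]

lemma integral_sum_answerEntropy_ge (hc : S.IsCorrect) (hp : S.IsPrivate) (hN : 1 ≤ N)
    (hM : 1 ≤ M) (j : ℕ) (T : Finset (Fin K)) (θ : Fin K) (hθ : θ ∉ T) (hj : Tᶜ.card = j) :
    L * Real.log M * ∑ i ∈ Finset.range j, 1 / (N : ℝ) ^ i ≤
      ∑ n, ∫ ω, S.answerEntropy T n (S.query θ n ω) ∂S.P := by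
  induction j generalizing T θ with
  | zero =>
    rw [Finset.range_zero, Finset.sum_empty, mul_zero]
    exact Finset.sum_nonneg fun n _ => integral_nonneg fun ω => condEntropy_nonneg _ _
  | succ j ih =>
    have hcard : (insert θ T)ᶜ.card = j := by
      rw [Finset.compl_insert, Finset.card_erase_of_mem (Finset.mem_compl.2 hθ), hj]
      rfl
    have hnext : L * Real.log M * ∑ i ∈ Finset.range j, 1 / (N : ℝ) ^ i ≤
        ∑ n, ∫ ω, S.answerEntropy (insert θ T) n (S.query θ n ω) ∂S.P := by
      -- With no message left the bound is trivial. Otherwise privacy transfers the induction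
      -- hypothesis from `θ'` to `θ` at each database.
      rcases Nat.eq_zero_or_pos j with rfl | hpos
      · rw [Finset.range_zero, Finset.sum_empty, mul_zero]
        exact Finset.sum_nonneg fun n _ => integral_nonneg fun ω => condEntropy_nonneg _ _
      · obtain ⟨θ', hθ'⟩ := Finset.card_pos.1 (hcard ▸ hpos)
        refine (ih (insert θ T) θ' (Finset.mem_compl.1 hθ') hcard).trans_eq ?_
        exact Finset.sum_congr rfl fun n _ => hp.integral_answerEntropy_eq _ _ _ _
    calc _ = L * Real.log M +
          1 / N * (L * Real.log M * ∑ i ∈ Finset.range j, 1 / (N : ℝ) ^ i) := by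
          rw [Finset.sum_range_succ', mul_add, pow_zero, div_one, mul_one, add_comm,
            mul_left_comm (1 / (N : ℝ)), Finset.mul_sum (Finset.range j) _ (1 / (N : ℝ))]
          congr 2
          refine Finset.sum_congr rfl fun i _ => ?_
          rw [pow_succ', one_div_mul_one_div]
      _ ≤ L * Real.log M +
          1 / N * ∑ n, ∫ ω, S.answerEntropy (insert θ T) n (S.query θ n ω) ∂S.P := by
          gcongr
      _ = ∫ ω, (L * Real.log M +
          1 / N * ∑ n, S.answerEntropy (insert θ T) n (S.query θ n ω)) ∂S.P := by
          rw [integral_add (integrable_const _) ((integrable_finsetSum _ fun n _ =>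
            S.integrable_answerEntropy _ θ n).const_mul _), integral_const, probReal_univ,
            one_smul, integral_const_mul (1 / (N : ℝ)),
            integral_finsetSum _ fun n _ => S.integrable_answerEntropy _ θ n]
      _ ≤ ∫ ω, ∑ n, S.answerEntropy T n (S.query θ n ω) ∂S.P := by
          refine integral_mono ((integrable_const _).add ((integrable_finsetSum _ fun n _ =>
            S.integrable_answerEntropy _ θ n).const_mul _)) (integrable_finsetSum _ fun n _ =>
            S.integrable_answerEntropy _ θ n) fun ω => ?_
          exact hc.sum_answerEntropy_ge hN hM hθ ω
      _ = _ := integral_finsetSum _ fun n _ => S.integrable_answerEntropy _ θ n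

lemma answerEntropy_empty_le (S : PIRScheme K N L M M') (n : Fin N) (q : S.Query n) :
    S.answerEntropy ∅ n q ≤ S.answerLength n q * Real.log M' := by
  obtain ⟨s, hs, hmem⟩ := card_list_length_le M' (S.answerLength n q)
  refine (condEntropy_le_log_of_mem _ _ s (fun w => hmem _ (S.length_answer n q w))
    (fun x y => by simp [funext_iff])).trans ?_
  rw [hs, Nat.cast_pow, Real.log_pow]

theorem Achieves.le_downloadCost {D : ℕ} (hS : S.Achieves D) (hK : 1 ≤ K) (hN : 1 ≤ N)
    (hM : 1 ≤ M) (hM' : 2 ≤ M') :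
    (L : ℝ) * Real.logb M' M / pirCapacity K N ≤ D := by
  obtain ⟨hc, hp, hD⟩ := hS
  have hlog : 0 < Real.log M' := Real.log_pos (by exact_mod_cast hM')
  have h := integral_sum_answerEntropy_ge hc hp hN hM K ∅ ⟨0, hK⟩ (by simp) (by simp)
  rw [← integral_finsetSum _ fun n _ => S.integrable_answerEntropy _ _ n] at h
  have h2 : ∫ ω, ∑ n, S.answerEntropy ∅ n (S.query ⟨0, hK⟩ n ω) ∂S.P ≤
      ∫ _, (D * Real.log M' : ℝ) ∂S.P := by
    refine integral_mono (integrable_finsetSum _ fun n _ => S.integrable_answerEntropy _ _ n)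
      (integrable_const _) fun ω => ?_
    calc _ ≤ ∑ n, S.answerLength n (S.query ⟨0, hK⟩ n ω) * Real.log M' :=
          Finset.sum_le_sum fun n _ => S.answerEntropy_empty_le n _
      _ = (∑ n, S.answerLength n (S.query ⟨0, hK⟩ n ω) : ℕ) * Real.log M' := by
          rw [Nat.cast_sum, Finset.sum_mul]
      _ ≤ _ := by
          gcongr
          exact hD.2 ⟨_, ω, rfl⟩
  rw [integral_const, probReal_univ, one_smul] at h2
  rw [pirCapacity, div_inv_eq_mul, Real.logb, mul_div_assoc', div_mul_eq_mul_div,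
    div_le_iff₀ hlog]
  exact h.trans h2

end PIRScheme

/-! ### Schemes with uniform randomness and constant answer lengths -/

/-- A correct and private retrieval scheme for messages `I → A` indexed by `κ`, with databases `δ`,
in which the symbols in the answer of database `n` are indexed by `J n`.  The randomness is
uniform on a finite set, and privacy is witnessed by permutations of that set. -/
structure UniformScheme (κ δ I : Type) (J : δ → Type) (A : Type) where
  /-- the set of random seeds -/
  Ω : Type
  [fintypeΩ : Fintype Ω]
  [nonemptyΩ : Nonempty Ω]
  /-- the queries to a database -/
  Query : δ → Type
  /-- the query sent to a database -/
  query : κ → (n : δ) → Ω → Query n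
  /-- the answer of a database -/
  answer : (n : δ) → Query n → (κ → I → A) → J n → A
  correct : ∀ θ ω w w', (∀ n, answer n (query θ n ω) w = answer n (query θ n ω) w') → w θ = w' θ
  isPrivate : ∀ θ θ' n, ∃ π : Ω ≃ Ω, ∀ ω, query θ' n ω = query θ n (π ω)

namespace UniformScheme

attribute [instance] fintypeΩ nonemptyΩ

variable {κ δ I I' : Type} {J J' : δ → Type} {A : Type}

/-- The scheme that uses two schemes independently, on two parts of the messages. -/
def append (S : UniformScheme κ δ I J A) (S' : UniformScheme κ δ I' J' A) :
    UniformScheme κ δ (I ⊕ I') (fun n => J n ⊕ J' n) A where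
  Ω := S.Ω × S'.Ω
  Query n := S.Query n × S'.Query n
  query θ n ω := (S.query θ n ω.1, S'.query θ n ω.2)
  answer n q w := Sum.elim (S.answer n q.1 fun k => w k ∘ Sum.inl)
    (S'.answer n q.2 fun k => w k ∘ Sum.inr)
  correct θ ω w w' h := by
    have h1 := S.correct θ ω.1 (fun k => w k ∘ Sum.inl) (fun k => w' k ∘ Sum.inl)
      fun n => funext fun j => congr_fun (h n) (Sum.inl j)
    have h2 := S'.correct θ ω.2 (fun k => w k ∘ Sum.inr) (fun k => w' k ∘ Sum.inr)
      fun n => funext fun j => congr_fun (h n) (Sum.inr j)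
    funext i
    rcases i with i | i
    · exact congr_fun h1 i
    · exact congr_fun h2 i
  isPrivate θ θ' n := by
    obtain ⟨π, hπ⟩ := S.isPrivate θ θ' n
    obtain ⟨π', hπ'⟩ := S'.isPrivate θ θ' n
    exact ⟨π.prodCongr π', fun ω => Prod.ext (hπ _) (hπ' _)⟩

/-- The scheme for messages without symbols. -/
def empty (κ δ A : Type) : UniformScheme κ δ Empty (fun _ => Empty) A where
  Ω := Unit
  Query _ := Unit
  query _ _ _ := ()
  answer _ _ _ := Empty.elim
  correct _ _ _ _ _ := Subsingleton.elim _ _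
  isPrivate _ _ _ := ⟨Equiv.refl _, fun _ => rfl⟩

/-- `c` symbols are retrieved from `c + 1` databases `f 0, …, f c`, each of which sends one symbol:
database `n` is asked for the sum over all messages of one random symbol or a dummy zero, where
the position in the desired message is cyclically shifted by `g n`. -/
def cyclic (κ δ A : Type) [Fintype κ] [DecidableEq κ] [AddCommGroup A] (c : ℕ)
    (f : Fin (c + 1) → δ) (g : δ → Fin (c + 1)) (hfg : ∀ j, g (f j) = j) :
    UniformScheme κ δ (Fin c) (fun n => {j // f j = n}) A where
  Ω := κ → Fin (c + 1)
  Query _ := κ → Fin (c + 1)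
  query θ n v := v + Pi.single θ (g n)
  answer _ q w _ := ∑ k, Fin.cases (motive := fun _ => A) 0 (w k) (q k)
  correct θ v w w' h := by
    have key : ∀ j : Fin (c + 1), ∀ w : κ → Fin c → A,
        ∑ k, Fin.cases (motive := fun _ => A) 0 (w k)
          ((v + Pi.single θ (g (f j)) : κ → Fin (c + 1)) k) =
        Fin.cases (motive := fun _ => A) 0 (w θ) (v θ + j) +
          ∑ k ∈ Finset.univ.erase θ, Fin.cases (motive := fun _ => A) 0 (w k) (v k) := by
      intro j w
      rw [← Finset.add_sum_erase _ _ (Finset.mem_univ θ)]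
      congr 1
      · simp [hfg]
      · refine Finset.sum_congr rfl fun k hk => ?_
        rw [Pi.add_apply, Pi.single_eq_of_ne (Finset.ne_of_mem_erase hk), add_zero]
    have hj : ∀ j : Fin (c + 1), Fin.cases (motive := fun _ => A) 0 (w θ) (v θ + j) +
          ∑ k ∈ Finset.univ.erase θ, Fin.cases (motive := fun _ => A) 0 (w k) (v k) =
        Fin.cases (motive := fun _ => A) 0 (w' θ) (v θ + j) +
          ∑ k ∈ Finset.univ.erase θ, Fin.cases (motive := fun _ => A) 0 (w' k) (v k) := by
      intro j
      rw [← key, ← key]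
      exact congr_fun (h (f j)) ⟨j, rfl⟩
    -- The shift `-v θ` hits the dummy position, so that answer is the interference alone; it
    -- cancels from all the other answers.
    have h0 := hj (-v θ)
    rw [add_neg_cancel, Fin.cases_zero, Fin.cases_zero, zero_add, zero_add] at h0
    funext i
    have hi := hj (i.succ - v θ)
    rw [add_sub_cancel, Fin.cases_succ, Fin.cases_succ, h0] at hi
    exact add_right_cancel hi
  isPrivate θ θ' n := by
    refine ⟨(Equiv.addRight (Pi.single θ' (g n))).trans
      (Equiv.addRight (Pi.single θ (g n))).symm, fun v => ?_⟩
    simp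

end UniformScheme

/-- There is a scheme with `K` messages of `L` symbols, `N` databases and download cost `D`. -/
def IsFeasible (K N : ℕ) (A : Type) (L D : ℕ) : Prop :=
  ∃ (I : Type) (_ : Fintype I) (J : Fin N → Type) (_ : ∀ n, Fintype (J n)),
    Fintype.card I = L ∧ ∑ n, Fintype.card (J n) = D ∧
      Nonempty (UniformScheme (Fin K) (Fin N) I J A)

namespace IsFeasible

variable {K N : ℕ} {A : Type} {L L' D D' : ℕ}

lemma add (h : IsFeasible K N A L D) (h' : IsFeasible K N A L' D') :
    IsFeasible K N A (L + L') (D + D') := by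
  obtain ⟨I, _, J, _, hI, hJ, ⟨S⟩⟩ := h
  obtain ⟨I', _, J', _, hI', hJ', ⟨S'⟩⟩ := h'
  refine ⟨I ⊕ I', inferInstance, fun n => J n ⊕ J' n, fun n => inferInstance, ?_, ?_,
    ⟨S.append S'⟩⟩
  · rw [Fintype.card_sum, hI, hI']
  · simp_rw [Fintype.card_sum]
    rw [Finset.sum_add_distrib, hJ, hJ']

lemma zero (K N : ℕ) (A : Type) : IsFeasible K N A 0 0 :=
  ⟨Empty, inferInstance, fun _ => Empty, fun _ => inferInstance, by simp, by simp,
    ⟨UniformScheme.empty _ _ _⟩⟩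

lemma mul (h : IsFeasible K N A L D) (a : ℕ) : IsFeasible K N A (a * L) (a * D) := by
  induction a with
  | zero => simpa using zero K N A
  | succ a ih =>
    rw [add_mul, add_mul, one_mul, one_mul]
    exact ih.add h

lemma succ_of_lt [AddCommGroup A] {c : ℕ} (hc : c < N) : IsFeasible K N A c (c + 1) := by
  refine ⟨Fin c, inferInstance, fun n => {j : Fin (c + 1) // Fin.castLE hc j = n},
    fun n => inferInstance, Fintype.card_fin c, ?_,
    ⟨UniformScheme.cyclic _ _ A c (Fin.castLE hc) (fun n => Fin.ofNat (c + 1) n) fun j => ?_⟩⟩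
  · rw [← Fintype.card_sigma, Fintype.card_congr (Equiv.sigmaFiberEquiv _), Fintype.card_fin]
  · simp

end IsFeasible

/-! ### The scheme based on side information -/

/-- An item is a set of messages, whose symbols are added up, with a sequence of nonzero residues
of length one less than the size of this set. -/
abbrev SumItem (κ : Type) (N : ℕ) [NeZero N] : Type :=
  Σ S : Finset κ, {l : List {d : Fin N // d ≠ 0} // l.length + 1 = S.card}

/-- Writing `l.length + 1 = m` leaves no list for `m = 0`, so the empty set of messages carries no
item. -/
instance fintypeListLengthSucc (α : Type) [Fintype α] :
    (m : ℕ) → Fintype {l : List α // l.length + 1 = m}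
  | 0 => ⟨∅, fun l => absurd l.2 (Nat.succ_ne_zero _)⟩
  | m + 1 => Fintype.ofEquiv (List.Vector α m) (Equiv.subtypeEquivRight fun l => by simp)

lemma card_listLengthSucc (α : Type) [Fintype α] (m : ℕ) :
    Fintype.card {l : List α // l.length + 1 = m} =
      if m = 0 then 0 else Fintype.card α ^ (m - 1) := by
  cases m with
  | zero =>
    rw [if_pos rfl, Fintype.card_eq_zero_iff]
    exact ⟨fun l => Nat.succ_ne_zero _ l.2⟩
  | succ m =>
    rw [if_neg (Nat.succ_ne_zero _), Nat.add_sub_cancel, ← card_vector]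
    exact Fintype.card_congr (Equiv.subtypeEquivRight fun l => by simp)

/-- Adjoining `k` adds the sets `insert k t` with `t ⊆ s`, which contribute `(a + 1) ^ s.card` by
the binomial theorem. -/
lemma sum_powerset_pow_card_pred {κ : Type*} [DecidableEq κ] (a : ℕ) (s : Finset κ) :
    ∑ t ∈ s.powerset, (if t.card = 0 then 0 else a ^ (t.card - 1)) =
      ∑ i ∈ Finset.range s.card, (a + 1) ^ i := by
  induction s using Finset.induction_on with
  | empty => simp
  | insert k s hk ih =>
    rw [Finset.sum_powerset_insert hk, ih, Finset.card_insert_of_notMem hk,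
      Finset.sum_range_succ, ← Finset.sum_pow_mul_eq_add_pow]
    congr 1
    refine Finset.sum_congr rfl fun t ht => ?_
    rw [Finset.card_insert_of_notMem fun h => hk (Finset.mem_powerset.1 ht h)]
    simp

lemma sum_mem_pow_card_pred {κ : Type*} [Fintype κ] [DecidableEq κ] (a : ℕ) (k : κ) :
    ∑ t : Finset κ, (if k ∈ t then (if t.card = 0 then 0 else a ^ (t.card - 1)) else 0) =
      (a + 1) ^ (Fintype.card κ - 1) := by
  have hu : (Finset.univ : Finset (Finset κ)) =
      (insert k (Finset.univ.erase k)).powerset := by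
    rw [Finset.insert_erase (Finset.mem_univ k), Finset.powerset_univ]
  have hk : k ∉ (Finset.univ : Finset κ).erase k := Finset.notMem_erase _ _
  rw [hu, Finset.sum_powerset_insert hk, Finset.sum_eq_zero, zero_add, ← Finset.card_univ,
    ← Finset.card_erase_of_mem (Finset.mem_univ k), ← Finset.sum_pow_mul_eq_add_pow]
  · refine Finset.sum_congr rfl fun t ht => ?_
    rw [Finset.card_insert_of_notMem fun h => hk (Finset.mem_powerset.1 ht h)]
    simp
  · intro t ht
    exact if_neg fun h => hk (Finset.mem_powerset.1 ht h)

namespace SumItem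

variable {κ : Type} {N : ℕ} [NeZero N]

lemma card_residue : Fintype.card {d : Fin N // d ≠ 0} + 1 = N := by
  rw [Fintype.card_subtype_compl, Fintype.card_fin, Fintype.card_unique]
  exact Nat.sub_add_cancel (NeZero.pos N)

lemma card_eq [Fintype κ] [DecidableEq κ] :
    Fintype.card (SumItem κ N) = ∑ i ∈ Finset.range (Fintype.card κ), N ^ i := by
  rw [Fintype.card_sigma]
  simp_rw [card_listLengthSucc]
  rw [← Finset.powerset_univ, sum_powerset_pow_card_pred, card_residue, Finset.card_univ]

lemma card_mem [Fintype κ] [DecidableEq κ] (k : κ) :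
    Fintype.card {i : SumItem κ N // k ∈ i.1} = N ^ (Fintype.card κ - 1) := by
  rw [Fintype.card_subtype, Finset.card_filter, Fintype.sum_sigma]
  have h : ∀ S : Finset κ,
      ∑ _l : {l : List {d : Fin N // d ≠ 0} // l.length + 1 = S.card}, (if k ∈ S then 1 else 0) =
        if k ∈ S then (if S.card = 0 then 0 else
          Fintype.card {d : Fin N // d ≠ 0} ^ (S.card - 1)) else 0 := by
    intro S
    rw [← card_listLengthSucc, Finset.sum_const, smul_eq_mul, mul_ite, mul_one, mul_zero,
      Finset.card_univ]
  rw [Finset.sum_congr rfl fun S _ => h S, sum_mem_pow_card_pred, card_residue]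

/-- The database that is asked for an item. -/
def database (i : SumItem κ N) : Fin N := (i.2.1.map Subtype.val).sum

lemma ext_val {i i' : SumItem κ N} (h : i.1 = i'.1) (h' : i.2.1 = i'.2.1) : i = i' := by
  obtain ⟨S, l, hl⟩ := i
  obtain ⟨S', l', hl'⟩ := i'
  obtain rfl : S = S' := h
  obtain rfl : l = l' := h'
  rfl

lemma one_lt_card {θ k : κ} {i : SumItem κ N} (hk : k ∈ i.1) (hkθ : k ≠ θ) (h : θ ∈ i.1) :
    1 < i.1.card := Finset.one_lt_card.2 ⟨k, hk, θ, h, hkθ⟩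

variable [DecidableEq κ]

/-- The item, from another database, that gives the interference in an item containing the
desired message `θ`. -/
def interference (θ : κ) (i : SumItem κ N) : SumItem κ N :=
  if h : θ ∈ i.1 ∧ 1 < i.1.card then
    ⟨i.1.erase θ, i.2.1.tail, by
      have := i.2.2
      have := h.2
      rw [List.length_tail, Finset.card_erase_of_mem h.1]
      omega⟩
  else i

lemma interference_of_notMem {θ : κ} {i : SumItem κ N} (h : θ ∉ i.1) : interference θ i = i :=
  dif_neg fun h' => h h'.1

lemma interference_fst {θ : κ} {i : SumItem κ N} (h : θ ∈ i.1) (h' : 1 < i.1.card) :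
    (interference θ i).1 = i.1.erase θ := by
  rw [interference, dif_pos ⟨h, h'⟩]

lemma exists_eq_cons_interference {θ : κ} {i : SumItem κ N} (h : θ ∈ i.1) (h' : 1 < i.1.card) :
    ∃ a, i.2.1 = a :: (interference θ i).2.1 := by
  have hl := i.2.2
  rw [interference, dif_pos ⟨h, h'⟩]
  obtain ⟨a, l, hal⟩ := List.exists_cons_of_length_pos (show 0 < i.2.1.length by omega)
  exact ⟨a, by simp [hal]⟩

lemma mem_interference {θ k : κ} {i : SumItem κ N} (hk : k ∈ i.1) (hkθ : k ≠ θ) :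
    k ∈ (interference θ i).1 := by
  by_cases h : θ ∈ i.1
  · rw [interference_fst h (one_lt_card hk hkθ h)]
    exact Finset.mem_erase.2 ⟨hkθ, hk⟩
  · rwa [interference_of_notMem h]

/-- Passing to the interference drops the first residue, which the common database recovers. If only
one of the items contains `θ`, the dropped residue would have to be zero. -/
lemma interference_injOn {θ k : κ} (hkθ : k ≠ θ) {i i' : SumItem κ N} (hk : k ∈ i.1)
    (hk' : k ∈ i'.1) (hdb : i.database = i'.database)
    (hi : interference θ i = interference θ i') : i = i' := by
  by_cases h : θ ∈ i.1 <;> by_cases h' : θ ∈ i'.1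
  · obtain ⟨a, ha⟩ := exists_eq_cons_interference h (one_lt_card hk hkθ h)
    obtain ⟨a', ha'⟩ := exists_eq_cons_interference h' (one_lt_card hk' hkθ h')
    have h1 := congr_arg Sigma.fst hi
    rw [interference_fst h (one_lt_card hk hkθ h),
      interference_fst h' (one_lt_card hk' hkθ h')] at h1
    refine ext_val ?_ ?_
    · rw [← Finset.insert_erase h, h1, Finset.insert_erase h']
    · rw [database, database, ha, ha', hi, List.map_cons, List.map_cons, List.sum_cons,
        List.sum_cons] at hdb
      rw [ha, ha', hi, Subtype.ext (add_right_cancel hdb)]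
  · obtain ⟨a, ha⟩ := exists_eq_cons_interference h (one_lt_card hk hkθ h)
    rw [interference_of_notMem h'] at hi
    rw [database, ha, hi, List.map_cons, List.sum_cons] at hdb
    exact absurd (add_eq_right.1 hdb) a.2
  · obtain ⟨a, ha⟩ := exists_eq_cons_interference h' (one_lt_card hk' hkθ h')
    rw [interference_of_notMem h] at hi
    have hdb' := hdb.symm
    rw [database, ha, ← hi, List.map_cons, List.sum_cons] at hdb'
    exact absurd (add_eq_right.1 hdb') a.2
  · rwa [interference_of_notMem h, interference_of_notMem h'] at hi

/-- The item whose label determines the position of the symbol of message `k` in item `i`, when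
message `θ` is desired. -/
def symbolItem (θ k : κ) (i : SumItem κ N) : SumItem κ N :=
  if k = θ then i else interference θ i

lemma mem_symbolItem {θ k : κ} {i : SumItem κ N} (hk : k ∈ i.1) : k ∈ (symbolItem θ k i).1 := by
  unfold symbolItem
  split_ifs with h
  · exact hk
  · exact mem_interference hk h

/-- Within one database distinct items use distinct symbols of message `k`, whatever `θ` is; a
random permutation of the symbols then hides `θ`. -/
lemma symbolItem_injOn {θ k : κ} {i i' : SumItem κ N} (hk : k ∈ i.1)
    (hk' : k ∈ i'.1) (hdb : i.database = i'.database)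
    (hi : symbolItem θ k i = symbolItem θ k i') : i = i' := by
  unfold symbolItem at hi
  split_ifs at hi with h
  · exact hi
  · exact interference_injOn h hk hk' hdb hi

lemma exists_labeling [Fintype κ] (k : κ) :
    ∃ e : SumItem κ N → Fin (N ^ (Fintype.card κ - 1)),
      (∀ i i', k ∈ i.1 → k ∈ i'.1 → e i = e i' → i = i') ∧ ∀ j, ∃ i, k ∈ i.1 ∧ e i = j := by
  have E : {i : SumItem κ N // k ∈ i.1} ≃ Fin (N ^ (Fintype.card κ - 1)) :=
    Fintype.equivFinOfCardEq (card_mem k)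
  -- Items without `k` get the arbitrary label 0; `card_mem` makes the others correspond exactly to
  -- the positions.
  refine ⟨fun i => if h : k ∈ i.1 then E ⟨i, h⟩ else ⟨0, pow_pos (NeZero.pos N) _⟩, ?_, ?_⟩
  · intro i i' h h' hi
    simp only [h, h', dif_pos] at hi
    exact congr_arg Subtype.val (E.injective hi)
  · intro j
    refine ⟨(E.symm j).1, (E.symm j).2, ?_⟩
    simp [(E.symm j).2]

end SumItem

lemma sum_option_elim_eq {κ I A : Type} [Fintype κ] [DecidableEq κ] [AddCommGroup A]
    (S : Finset κ) (f : κ → I) (w : κ → I → A) :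
    ∑ k, ((if k ∈ S then some (f k) else none : Option I).elim 0 (w k)) =
      ∑ k ∈ S, w k (f k) := by
  have h : ∀ k, ((if k ∈ S then some (f k) else none : Option I).elim 0 (w k)) =
      if k ∈ S then w k (f k) else 0 := by
    intro k
    split_ifs <;> rfl
  simp_rw [h]
  rw [Finset.sum_ite_mem, Finset.univ_inter]

open SumItem in
/-- The scheme that retrieves `N ^ (K - 1)` symbols with `1 + N + ⋯ + N ^ (K - 1)` downloaded ones:
the symbols of each message are randomly permuted, and sums of symbols that include the desired
message use interference that is known from another database. -/
noncomputable def UniformScheme.sideInformation (κ A : Type) (N : ℕ) [NeZero N] [Fintype κ]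
    [DecidableEq κ] [AddCommGroup A] : UniformScheme κ (Fin N) (Fin (N ^ (Fintype.card κ - 1)))
      (fun n => {i : SumItem κ N // i.database = n}) A where
  Ω := κ → Equiv.Perm (Fin (N ^ (Fintype.card κ - 1)))
  Query n := {i : SumItem κ N // i.database = n} → κ → Option (Fin (N ^ (Fintype.card κ - 1)))
  query θ n σ i k :=
    if k ∈ i.1.1 then some (σ k ((exists_labeling k).choose (symbolItem θ k i.1))) else none
  answer _ q w i := ∑ k, (q i k).elim 0 (w k)
  correct θ σ w w' h := by
    have hsum : ∀ i : SumItem κ N,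
        ∑ k ∈ i.1, w k (σ k ((exists_labeling k).choose (symbolItem θ k i))) =
          ∑ k ∈ i.1, w' k (σ k ((exists_labeling k).choose (symbolItem θ k i))) := by
      intro i
      have := congr_fun (h i.database) ⟨i, rfl⟩
      simp only [sum_option_elim_eq] at this
      exact this
    funext l
    obtain ⟨i, hi, hil⟩ := (exists_labeling (N := N) θ).choose_spec.2 ((σ θ).symm l)
    have h1 := hsum i
    rw [← Finset.add_sum_erase _ _ hi, ← Finset.add_sum_erase _ _ hi] at h1
    have hrest : ∑ k ∈ i.1.erase θ, w k (σ k ((exists_labeling k).choose (symbolItem θ k i))) =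
        ∑ k ∈ i.1.erase θ, w' k (σ k ((exists_labeling k).choose (symbolItem θ k i))) := by
      by_cases hc : 1 < i.1.card
      · have h2 := hsum (interference θ i)
        have h3 : ∀ k ∈ i.1.erase θ, symbolItem θ k (interference θ i) = symbolItem θ k i := by
          intro k hk
          unfold symbolItem
          rw [if_neg (Finset.ne_of_mem_erase hk), if_neg (Finset.ne_of_mem_erase hk)]
          apply interference_of_notMem
          rw [interference_fst hi hc]
          exact Finset.notMem_erase _ _
        rw [interference_fst hi hc] at h2
        refine Eq.trans (Finset.sum_congr rfl fun k hk => ?_)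
          (h2.trans (Finset.sum_congr rfl fun k hk => ?_)) <;> rw [h3 k hk]
      · have : i.1.erase θ = ∅ := by
          rw [← Finset.card_eq_zero, Finset.card_erase_of_mem hi]
          omega
        rw [this, Finset.sum_empty, Finset.sum_empty]
    rw [hrest] at h1
    have h4 := add_right_cancel h1
    rw [symbolItem, if_pos rfl, hil, Equiv.apply_symm_apply] at h4
    exact h4
  isPrivate θ θ' n := by
    have hτ : ∀ k, ∃ τ : Equiv.Perm (Fin (N ^ (Fintype.card κ - 1))),
        ∀ i : {i : SumItem κ N // i.database = n ∧ k ∈ i.1},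
          τ ((exists_labeling k).choose (symbolItem θ k i.1)) =
            (exists_labeling k).choose (symbolItem θ' k i.1) := by
      intro k
      have hinj : ∀ θ : κ, Function.Injective
          fun i : {i : SumItem κ N // i.database = n ∧ k ∈ i.1} =>
            (exists_labeling k).choose (symbolItem θ k i.1) := by
        intro θ i i' hi
        exact Subtype.ext (symbolItem_injOn i.2.2 i'.2.2 (i.2.1.trans i'.2.1.symm)
          ((exists_labeling k).choose_spec.1 _ _ (mem_symbolItem i.2.2)
            (mem_symbolItem i'.2.2) hi))
      -- Both labelings are injective on the items of this database containing `k`, so some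
      -- permutation of positions carries one to the other.
      exact Equiv.Perm.exists_extending_pair _ _ (hinj θ) (hinj θ')
    choose τ hτ using hτ
    refine ⟨Equiv.piCongrRight fun k => Equiv.mulRight (τ k), fun σ => ?_⟩
    funext i k
    by_cases hk : k ∈ i.1.1
    · simp only [hk, if_true, Equiv.piCongrRight_apply, Pi.map_apply, Equiv.coe_mulRight,
        Equiv.Perm.mul_apply]
      rw [← hτ k ⟨i.1, i.2, hk⟩]
    · simp only [hk, if_false]

namespace IsFeasible

variable {K N : ℕ} {A : Type}

lemma sideInformation [AddCommGroup A] (hN : 1 ≤ N) :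
    IsFeasible K N A (N ^ (K - 1)) (∑ i ∈ Finset.range K, N ^ i) := by
  have : NeZero N := ⟨by omega⟩
  have S := UniformScheme.sideInformation (Fin K) A N
  rw [Fintype.card_fin] at S
  refine ⟨_, inferInstance, _, fun n => inferInstance, Fintype.card_fin _, ?_, ⟨S⟩⟩
  rw [← Fintype.card_sigma, Fintype.card_congr (Equiv.sigmaFiberEquiv _), SumItem.card_eq,
    Fintype.card_fin]

end IsFeasible

/-! ### Optimal message length and download cost -/

namespace IsFeasible

variable {K N : ℕ} {A : Type}

/-- The bound says `D ≤ ⌈m (n + 1) / n⌉`: full groups of `n` symbols cost `n + 1`, and a leftover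
group of `r > 0` symbols costs `r + 1`. -/
lemma exists_mul_lt [AddCommGroup A] {n : ℕ} (hn : 1 ≤ n) (m : ℕ) :
    ∃ D, IsFeasible K (n + 1) A m D ∧ n * D < m * (n + 1) + n := by
  have h1 : IsFeasible K (n + 1) A (m / n * n) (m / n * (n + 1)) :=
    (succ_of_lt (Nat.lt_succ_self n)).mul _
  have hm := Nat.div_add_mod m n
  rcases Nat.eq_zero_or_pos (m % n) with h0 | hpos
  · have h2 : m / n * n = m := by rw [mul_comm]; omega
    rw [h2] at h1
    refine ⟨_, h1, ?_⟩
    rw [← mul_assoc, mul_comm n, h2]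
    omega
  · have h2 := h1.add (succ_of_lt (A := A) (K := K) (N := n + 1)
      ((Nat.mod_lt m (by omega)).trans (Nat.lt_succ_self n)))
    rw [mul_comm (m / n) n, hm] at h2
    refine ⟨_, h2, ?_⟩
    calc n * (m / n * (n + 1) + (m % n + 1))
        = (n * (m / n) + m % n) * (n + 1) + n - m % n := by
          apply Nat.eq_sub_of_add_eq
          ring
      _ < (n * (m / n) + m % n) * (n + 1) + n := by omega
      _ = _ := by rw [hm]

lemma exists_lt [AddCommGroup A] (hK : 1 ≤ K) (hN : 1 ≤ N) (L : ℕ) :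
    ∃ D, IsFeasible K N A L D ∧
      N ^ (K - 1) * D < L * ∑ i ∈ Finset.range K, N ^ i + N ^ (K - 1) := by
  have hS := sideInformation (K := K) (A := A) hN
  obtain ⟨n, rfl⟩ : ∃ n, N = n + 1 := ⟨N - 1, by omega⟩
  rcases Nat.eq_zero_or_pos n with rfl | hn
  -- With one database the blocks have length one, so nothing remains.
  · have := hS.mul L
    simp only [zero_add, one_pow, mul_one] at this ⊢
    exact ⟨_, this, by omega⟩
  · set B := (n + 1) ^ (K - 1) with hB
    set G := ∑ i ∈ Finset.range K, (n + 1) ^ i with hG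
    have hBpos : 0 < B := by positivity
    have hGB : G * n + 1 = (n + 1) * B := by
      have h2 := geom_sum_mul_of_one_le (show 1 ≤ n + 1 by omega) K
      rw [Nat.add_sub_cancel] at h2
      rw [hG, h2, hB, ← pow_succ', Nat.sub_add_cancel hK]
      exact Nat.sub_add_cancel (Nat.pow_pos (Nat.succ_pos n))
    obtain ⟨D, hD, hlt⟩ := exists_mul_lt (K := K) (A := A) hn (L % B)
    have hL := Nat.div_add_mod' L B
    have h := (hS.mul (L / B)).add hD
    rw [hL] at h
    refine ⟨_, h, ?_⟩
    have hm := Nat.mod_lt L hBpos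
    -- After scaling by `n`, replacing `(n + 1) * B` by `n * G + 1` costs an error `L % B < B`,
    -- absorbed by the spare `B` that strictness of `hlt` provides in `h1`.
    refine lt_of_mul_lt_mul_left ?_ (Nat.zero_le n)
    have h1 : B * (n * D + 1) ≤ B * (L % B * (n + 1) + n) := Nat.mul_le_mul_left _ hlt
    have h2 : n * (L * G + B) = n * ((L / B * B + L % B) * G + B) := by rw [hL]
    have h3 : L % B * (G * n + 1) = L % B * ((n + 1) * B) := by rw [hGB]
    rw [h2]
    nlinarith

end IsFeasible

lemma inv_pirCapacity {K N : ℕ} (hK : 1 ≤ K) (hN : 1 ≤ N) :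
    (pirCapacity K N)⁻¹ = (∑ i ∈ Finset.range K, N ^ i : ℕ) / (N : ℝ) ^ (K - 1) := by
  have hN' : (N : ℝ) ≠ 0 := by exact_mod_cast (by omega : N ≠ 0)
  rw [pirCapacity, inv_inv, ← Finset.sum_range_reflect, Nat.cast_sum, Finset.sum_div]
  refine Finset.sum_congr rfl fun i hi => ?_
  have := Finset.mem_range.1 hi
  rw [Nat.cast_pow, div_eq_div_iff (by positivity) (by positivity), one_mul, ← pow_add]
  congr 1
  omega

/-! ### From uniform schemes to retrieval protocols -/

namespace UniformScheme

variable {K N L M : ℕ} {I : Type} {J : Fin N → Type} [∀ n, Fintype (J n)]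

/-- The retrieval protocol of a scheme with uniform randomness, with answers written as lists. -/
noncomputable def toPIRScheme (S : UniformScheme (Fin K) (Fin N) I J (Fin M)) (e : I ≃ Fin L) :
    PIRScheme K N L M M :=
  letI : MeasurableSpace S.Ω := ⊤
  haveI : MeasurableSingletonClass S.Ω := ⟨fun _ => trivial⟩
  { Ω := S.Ω
    measurableSpaceΩ := ⊤
    P := uniformOn Set.univ
    isProbabilityMeasure := inferInstance
    Query := S.Query
    measurableSpaceQuery := fun _ => ⊤
    query := S.query
    measurable_query := fun _ _ _ _ => trivial
    answer := fun n q w =>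
      List.ofFn (S.answer n q (fun k i => w k (e i)) ∘ (Fintype.equivFin (J n)).symm)
    measurableSet_answer := fun _ _ _ => trivial
    answerLength := fun n _ => Fintype.card (J n)
    length_answer := fun _ _ _ => List.length_ofFn }

variable (S : UniformScheme (Fin K) (Fin N) I J (Fin M)) (e : I ≃ Fin L)

lemma isCorrect_toPIRScheme [Nonempty (Fin M)] : (S.toPIRScheme e).IsCorrect := by
  classical
  intro θ
  -- Decode with any messages and seed consistent with the observed data; equal queries let
  -- `correct` compare them with the true messages.
  refine ⟨fun a q => if h : ∃ w : Messages K L M, ∃ ω, q = (fun n => S.query θ n ω) ∧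
    a = fun n => (S.toPIRScheme e).answer n (S.query θ n ω) w then h.choose θ
    else Classical.arbitrary _, fun ω w => ?_⟩
  have hex : ∃ w' : Messages K L M, ∃ ω', (fun n => S.query θ n ω) = (fun n => S.query θ n ω') ∧
      (fun n => (S.toPIRScheme e).answer n (S.query θ n ω) w) =
        fun n => (S.toPIRScheme e).answer n (S.query θ n ω') w' := ⟨w, ω, rfl, rfl⟩
  refine (dif_pos hex).trans ?_
  obtain ⟨ω', hq, ha⟩ := hex.choose_spec
  have h := S.correct θ ω (fun k i => hex.choose k (e i)) (fun k i => w k (e i)) fun n => by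
    have h1 := congr_fun ha n
    rw [← congr_fun hq n] at h1
    have h2 := List.ofFn_injective h1
    funext j
    have h3 := congr_fun h2 (Fintype.equivFin (J n) j)
    simpa using h3.symm
  funext l
  have hl := congr_fun h (e.symm l)
  simp only [Equiv.apply_symm_apply] at hl
  exact hl

lemma isPrivate_toPIRScheme : (S.toPIRScheme e).IsPrivate := by
  intro θ θ' n
  let : MeasurableSpace S.Ω := ⊤
  have : MeasurableSingletonClass S.Ω := ⟨fun _ => trivial⟩
  obtain ⟨π, hπ⟩ := S.isPrivate θ' θ n
  let : MeasurableSpace (S.Query n) := ⊤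
  -- A permutation of the seeds preserves the uniform measure.
  have hmap : (uniformOn (Set.univ : Set S.Ω)).map π = uniformOn Set.univ := by
    ext s hs
    rw [Measure.map_apply measurable_from_top hs, uniformOn_univ, uniformOn_univ,
      Measure.count_apply (measurable_from_top hs), Measure.count_apply hs, Set.encard_preimage_of_bijective
      π.bijective]
  refine ⟨measurable_from_top.aemeasurable, measurable_from_top.aemeasurable,
    ?_⟩
  have hq : (S.toPIRScheme e).query θ n = S.query θ' n ∘ π := funext hπ
  rw [hq]
  change Measure.map (S.query θ' n ∘ π) (uniformOn Set.univ) =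
    Measure.map (S.query θ' n) (uniformOn Set.univ)
  rw [← Measure.map_map measurable_from_top measurable_from_top, hmap]

lemma achieves_toPIRScheme [Nonempty (Fin M)] (hK : 1 ≤ K) :
    (S.toPIRScheme e).Achieves (∑ n, Fintype.card (J n)) := by
  refine ⟨S.isCorrect_toPIRScheme e, S.isPrivate_toPIRScheme e,
    ⟨⟨0, hK⟩, (Classical.arbitrary S.Ω : S.Ω), rfl⟩, ?_⟩
  rintro d ⟨θ, ω, rfl⟩
  exact le_rfl

end UniformScheme

namespace PIRScheme

variable {K N L L' A M M' D : ℕ}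

lemma Achieves.reencode [Nonempty (Fin M)] {S : PIRScheme K N L' A M'} (hS : S.Achieves D)
    {e : (Fin L → Fin M) → (Fin L' → Fin A)} (he : Function.Injective e) :
    (S.reencode e).Achieves D := by
  refine ⟨fun θ => ?_, hS.2.1, hS.2.2⟩
  obtain ⟨decode, hd⟩ := hS.1 θ
  refine ⟨fun a q => Function.invFun e (decode a q), fun ω w => ?_⟩
  have h := hd ω fun k => e (w k)
  exact (congr_arg (Function.invFun e) h).trans (Function.leftInverse_invFun he _)

/-- For equal alphabets, the optimal download cost `⌈L / C⌉` is achieved. -/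
lemma exists_achieves_ceil (hK : 1 ≤ K) (hN : 1 ≤ N) (hM : 2 ≤ M) (L : ℕ) :
    ∃ S : PIRScheme K N L M M, S.Achieves ⌈(L : ℝ) / pirCapacity K N⌉₊ := by
  have : NeZero M := ⟨by omega⟩
  obtain ⟨D, ⟨I, _, J, _, hI, hJ, ⟨S⟩⟩, hlt⟩ :=
    IsFeasible.exists_lt (A := Fin M) hK hN L
  have hS := S.achieves_toPIRScheme (Fintype.equivFinOfCardEq hI) hK
  rw [hJ] at hS
  suffices h : D = ⌈(L : ℝ) / pirCapacity K N⌉₊ from ⟨_, h ▸ hS⟩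
  -- The construction gives `D < L / C + 1`; the reverse inequality is the general lower bound.
  refine le_antisymm ?_ (Nat.ceil_le.2 ?_)
  · rcases Nat.eq_zero_or_pos D with rfl | hpos
    · exact Nat.zero_le _
    obtain ⟨d, rfl⟩ : ∃ d, D = d + 1 := ⟨D - 1, by omega⟩
    rw [Nat.succ_le_iff, Nat.lt_ceil, div_eq_mul_inv, inv_pirCapacity hK hN, mul_div_assoc',
      lt_div_iff₀ (by positivity)]
    rw [mul_add, mul_one, add_lt_add_iff_right, mul_comm] at hlt
    exact_mod_cast hlt
  · have h := hS.le_downloadCost hK hN (by omega) hM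
    rwa [Real.logb_self_eq_one (by exact_mod_cast hM), mul_one] at h

end PIRScheme

/-! ### Re-encoding and the gap between the bounds -/

lemma exists_injective_reencoding {L M M' : ℕ} (hM : 2 ≤ M) (hM' : 2 ≤ M') :
    ∃ e : (Fin L → Fin M) → (Fin (reencodedLength L M M') → Fin M'), Function.Injective e := by
  have h : M ^ L ≤ M' ^ reencodedLength L M M' := by
    have h1 : (L : ℝ) * Real.logb M' M ≤ reencodedLength L M M' := Nat.le_ceil _
    have hlog : 0 < Real.log M' := Real.log_pos (by exact_mod_cast hM')
    rw [Real.logb, mul_div_assoc', div_le_iff₀ hlog, ← Real.log_pow, ← Real.log_pow,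
      Real.log_le_log_iff (by positivity) (by positivity)] at h1
    exact_mod_cast h1
  obtain ⟨e⟩ := Function.Embedding.nonempty_of_card_le (α := Fin L → Fin M)
    (β := Fin (reencodedLength L M M') → Fin M') (by simpa using h)
  exact ⟨e, e.injective⟩

lemma inv_pirCapacity_le_two {K N : ℕ} (hN : 2 ≤ N) : (pirCapacity K N)⁻¹ ≤ 2 := by
  have hN' : (2 : ℝ) ≤ N := by exact_mod_cast hN
  rw [pirCapacity, inv_inv]
  calc ∑ i ∈ Finset.range K, 1 / (N : ℝ) ^ i ≤ ∑ i ∈ Finset.range K, (1 / 2 : ℝ) ^ i := by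
        refine Finset.sum_le_sum fun i _ => ?_
        rw [one_div_pow]
        gcongr
    _ ≤ 2 := sum_geometric_two_le K

lemma ceil_reencodedLength_div_le {K N L M M' : ℕ} (hM : 2 ≤ M) (hM' : 2 ≤ M')
    (h : 2 ≤ N ∨ N = 1 ∧ K ≤ 3) :
    ⌈(reencodedLength L M M' : ℝ) / pirCapacity K N⌉ ≤
      ⌈(L : ℝ) * Real.logb M' M / pirCapacity K N⌉ + 2 := by
  have hx : 0 ≤ (L : ℝ) * Real.logb M' M := mul_nonneg (Nat.cast_nonneg _)
    (Real.logb_nonneg (by exact_mod_cast hM') (by exact_mod_cast (by omega : 1 ≤ M)))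
  have hlt : (reencodedLength L M M' : ℝ) < L * Real.logb M' M + 1 := Nat.ceil_lt_add_one hx
  have hle : (L : ℝ) * Real.logb M' M / pirCapacity K N ≤
    ⌈(L : ℝ) * Real.logb M' M / pirCapacity K N⌉ := Int.le_ceil _
  rw [Int.ceil_le]
  push_cast
  rcases h with hN | ⟨rfl, hK⟩
  · have h0 : 0 ≤ (pirCapacity K N)⁻¹ := by
      rw [pirCapacity, inv_inv]
      positivity
    have h2 := inv_pirCapacity_le_two (K := K) hN
    simp only [div_eq_mul_inv] at hle ⊢
    nlinarith
  · have hC : (pirCapacity K 1)⁻¹ = K := by simp [pirCapacity]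
    simp only [div_eq_mul_inv, hC] at hle ⊢
    set z := ⌈(L : ℝ) * Real.logb M' M * K⌉
    rcases Nat.eq_zero_or_pos K with rfl | hpos
    · simp only [CharP.cast_eq_zero, mul_zero] at hle ⊢
      linarith
    have hK' : (K : ℝ) ≤ 3 := by exact_mod_cast hK
    have hK0 : (0 : ℝ) < K := by exact_mod_cast hpos
    -- The strict bound `L' < L log_{M'} M + 1` gives strictness here, and both sides are integers,
    -- so 3 improves to 2.
    have : (reencodedLength L M M' : ℝ) * K < z + 3 := by nlinarith
    have h3 : ((reencodedLength L M M' * K : ℕ) : ℤ) < z + 3 := by exact_mod_cast this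
    have h4 : ((reencodedLength L M M' * K : ℕ) : ℤ) ≤ z + 2 := by omega
    have h5 := Int.cast_le (R := ℝ).2 h4
    push_cast at h5
    exact h5

theorem theorem2 (K N L M M' : ℕ) (hK : 1 ≤ K) (hN : 1 ≤ N) (hM : 2 ≤ M) (hM' : 2 ≤ M')
    (hMM' : M' ≠ M) :
    -- achievability of `⌈L' / C⌉` by re-encoding
    (∃ (e : (Fin L → Fin M) → (Fin (reencodedLength L M M') → Fin M'))
        (S : PIRScheme K N (reencodedLength L M M') M' M'),
        Function.Injective e ∧
        S.Achieves ⌈(reencodedLength L M M' : ℝ) / pirCapacity K N⌉₊ ∧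
        (S.reencode e).Achieves ⌈(reencodedLength L M M' : ℝ) / pirCapacity K N⌉₊) ∧
    -- the lower bound for every scheme
    (∀ (S : PIRScheme K N L M M') (D : ℕ), S.Achieves D →
        ⌈(L : ℝ) * Real.logb M' M / pirCapacity K N⌉ ≤ (D : ℤ)) ∧
    -- the optimal download cost
    (∃ D : ℕ, IsOptimalDownloadCost K N L M M' D ∧
        ((2 ≤ N ∨ K ≤ 3) →
          (D : ℤ) = ⌈(reencodedLength L M M' : ℝ) / pirCapacity K N⌉ ∨
          (D : ℤ) = ⌈(reencodedLength L M M' : ℝ) / pirCapacity K N⌉ - 1 ∨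
          (D : ℤ) = ⌈(reencodedLength L M M' : ℝ) / pirCapacity K N⌉ - 2)) := by
  have : Nonempty (Fin M) := ⟨⟨0, by omega⟩⟩
  obtain ⟨e, he⟩ := exists_injective_reencoding (L := L) hM hM'
  obtain ⟨S, hS⟩ :=
    PIRScheme.exists_achieves_ceil hK hN hM' (reencodedLength L M M')
  have hlower : ∀ (S : PIRScheme K N L M M') (D : ℕ), S.Achieves D →
      ⌈(L : ℝ) * Real.logb M' M / pirCapacity K N⌉ ≤ (D : ℤ) := fun S D hS =>
    Int.ceil_le.2 (by exact_mod_cast hS.le_downloadCost hK hN (by omega) hM')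
  refine ⟨⟨e, S, he, hS, hS.reencode he⟩, hlower, ?_⟩
  classical
  have hex : ∃ d, ∃ S : PIRScheme K N L M M', S.Achieves d := ⟨_, _, hS.reencode he⟩
  refine ⟨Nat.find hex, ⟨Nat.find_spec hex, fun d hd => Nat.find_min' hex hd⟩, fun h => ?_⟩
  obtain ⟨S', hS'⟩ := Nat.find_spec hex
  have h1 := hlower S' _ hS'
  have h2 : ((Nat.find hex : ℕ) : ℤ) ≤ ⌈(reencodedLength L M M' : ℝ) / pirCapacity K N⌉ := by
    have h0 : 0 ≤ (reencodedLength L M M' : ℝ) / pirCapacity K N := by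
      unfold pirCapacity
      positivity
    rw [← Int.natCast_ceil_eq_ceil h0]
    exact_mod_cast Nat.find_min' hex ⟨_, hS.reencode he⟩
  have h3 := ceil_reencodedLength_div_le (K := K) (N := N) (L := L) hM hM' (by omega)
  omega
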